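/- Let $\mathbb X\subseteq\mathbb R$ be an interval (closedness, Borel sets and complements are relative to $\mathbb X$), and let $X=(X_t)_{t\ge 0}$ be a time-homogeneous continuous strong Markov process with values in $\mathbb X$, with law $\mathbb P^x$ and expectation $\mathbb E^x$ when started from $x\in\mathbb X$ (strong Markov with respect to the right-continuous filtration generated by $X$). Let $f:\mathbb X\to[0,\infty)$ be continuous and let $\delta:[0,\infty)\to(0,1]$ be continuous and non-increasing with $\delta(0)=1$ and $\delta(t)\to0$ as $t\to\infty$. For Borel $R\subseteq\mathbb X$ put $\rho(R):=\inf\{t>0: X_t\in R\}$ (with $\inf\emptyset=\infty$) and $$J(x,R):=\mathbb E^x\big[\delta(\rho(R))f(X_{\rho(R)})\big]\in[0,\infty],\qquad V(x,R):=\max\{f(x),J(x,R)\},$$ where $\delta(\rho(R))f(X_{\rho(R)}):=\limsup_{t\to\infty}\delta(t)f(X_t)$ on $\{\rho(R)=\infty\}$. Let $S_R:=\{f>J(\cdot,R)\}$, $I_R:=\{f=J(\cdot,R)\}$, $C_R:=\{f<J(\cdot,R)\}$ and $\Theta(R):=S_R\cup(I_R\cap R)$. A Borel set $R$ is an equilibrium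 if $\Theta(R)=R$; it is an optimal equilibrium if moreover $V(x,R)\ge V(x,T)$ for every equilibrium $T$ and every $x\in\mathbb X$. Let $R^*$ be the intersection of all closed equilibria. For $x\notin R^*$ let $\ell_*(x):=\sup\{y\in R^*:y<x\}$, or $\inf\mathbb X\in[-\infty,\infty)$ if there is no such $y$, and $r_*(x):=\inf\{y\in R^*:y>x\}$, or $\sup\mathbb X\in(-\infty,\infty]$ if there is no such $y$. Assume that - for every $x\in\mathbb X$, $\delta(t)f(X_t)\to0$ as $t\to\infty$, $\mathbb P^x$-almost surely; - $X$ is regular: for every $x$ in the interior of $\mathbb X$ and every $y\in\mathbb X$, $\mathbb P^x(T_y<\infty)>0$, where $T_y:=\inf\{t\ge0:X_t=y\}$; - $\delta(s)\delta(t)<\delta(s+t)$ for all $s,t>0$; - $R^*$ is an optimal equilibrium. Let $T^*$ be any closed optimal equilibrium. Then for every $x\in\mathbb X\setminus R^*$: 1. if $(\ell_*(x),r_*(x))\cap C_{R^*}\ne\emptyset$, then $T^*\cap(\ell_*(x),r_*(x))=\emptyset$; 2. if $(\ell_*(x),r_*(x))\cap C_{R^*}=\emptyset$ and $f\not\equiv0$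 on $(\ell_*(x),r_*(x))$, then $T^*\cap(\ell_*(x),r_*(x))=\emptyset$ or $(\ell_*(x),r_*(x))\subseteq T^*$; 3. if $(\ell_*(x),r_*(x))\cap C_{R^*}=\emptyset$ and $f\equiv0$ on $(\ell_*(x),r_*(x))$, then $R^*\cup A$ is an optimal equilibrium for every Borel set $A\subseteq(\ell_*(x),r_*(x))$. -/

import Mathlib

open MeasureTheory ProbabilityTheory Filter Set
open scoped NNReal ENNReal Topology

noncomputable section

namespace NonExpStopping

variable {S : Set ℝ} {Ω : Type*} [MeasurableSpace Ω]

/-! The state space is the subtype of an interval `S ⊆ ℝ` (topology and Borel sets are the ones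
relative to `S`), time is `ℝ≥0`, the process is `X : ℝ≥0 → Ω → S`, and `P x` is the law on `Ω`
of the process started from `x : S`. -/

/-- `X`, under the laws `P x`, `x ∈ S`, is a time-homogeneous continuous strong Markov process.
The filtration is the right-continuous version of the one generated by `X`; `strong_markov` says
that, for every stopping time `τ` of it, the conditional law of the shifted path `X_{τ + ·}` given
the information up to time `τ` is, on `{τ < ∞}`, the law of the process started from `X_τ`. -/
structure IsContinuousStrongMarkov (X : ℝ≥0 → Ω → S) (P : Kernel S Ω) : Prop where
  isMarkovKernel : IsMarkovKernel P
  stronglyMeasurable : ∀ t, StronglyMeasurable (X t)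
  continuous_paths : ∀ ω, Continuous fun t => X t ω
  initial : ∀ x, ∀ᵐ ω ∂(P x), X 0 ω = x
  strong_markov : ∀ (τ : Ω → WithTop ℝ≥0)
    (hτ : IsStoppingTime (Filtration.natural X stronglyMeasurable).rightCont τ)
    (A : Set Ω), MeasurableSet[hτ.measurableSpace] A →
    ∀ B : Set (ℝ≥0 → S), MeasurableSet B → ∀ x : S,
      P x (A ∩ {ω | τ ω ≠ ⊤} ∩ {ω | (fun t => X ((τ ω).untopD 0 + t) ω) ∈ B}) =
        ∫⁻ ω in A ∩ {ω | τ ω ≠ ⊤},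
          P (X ((τ ω).untopD 0) ω) {ω' | (fun t => X t ω') ∈ B} ∂(P x)

/-- First hitting time of the point `y`: `T_y = inf {t ≥ 0 : X_t = y}`. -/
def hitTime (X : ℝ≥0 → Ω → S) (y : S) (ω : Ω) : ℝ≥0∞ :=
  ⨅ (t : ℝ≥0) (_ : X t ω = y), (t : ℝ≥0∞)

/-- Regularity: from every interior point every point of the state space is reached in finite
time with positive probability. -/
def IsRegular (X : ℝ≥0 → Ω → S) (P : Kernel S Ω) : Prop :=
  ∀ x : S, (x : ℝ) ∈ interior S → ∀ y : S, 0 < P x {ω | hitTime X y ω < ∞}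

/-- A discount function: non-increasing, continuous, `δ 0 = 1`, values in `(0, 1]`,
vanishing at infinity. -/
structure IsDiscount (δ : ℝ≥0 → ℝ≥0) : Prop where
  antitone : Antitone δ
  continuous : Continuous δ
  zero : δ 0 = 1
  pos : ∀ t, 0 < δ t
  le_one : ∀ t, δ t ≤ 1
  tendsto_zero : Tendsto δ atTop (𝓝 0)

/-- Decreasing impatience with strict inequality. -/
def StrictImpatience (δ : ℝ≥0 → ℝ≥0) : Prop :=
  ∀ s t : ℝ≥0, 0 < s → 0 < t → δ s * δ t < δ (s + t)

/-- `δ(t) f(X_t) → 0` as `t → ∞`, almost surely from every starting point. -/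
def DiscountedPayoffVanishes (X : ℝ≥0 → Ω → S) (P : Kernel S Ω) (δ : ℝ≥0 → ℝ≥0)
    (f : S → ℝ≥0) : Prop :=
  ∀ x, ∀ᵐ ω ∂(P x), Tendsto (fun t => δ t * f (X t ω)) atTop (𝓝 0)

/-- `ρ(R) = inf {t > 0 : X_t ∈ R}`, with `inf ∅ = ∞`. -/
def rho (X : ℝ≥0 → Ω → S) (R : Set S) (ω : Ω) : ℝ≥0∞ :=
  ⨅ (t : ℝ≥0) (_ : 0 < t ∧ X t ω ∈ R), (t : ℝ≥0∞)

open Classical in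
/-- The discounted payoff `δ(τ) f(X_τ)` at a time `τ ∈ [0, ∞]`, which for `τ = ∞` is
`limsup_{t → ∞} δ(t) f(X_t)`. -/
def discountedPayoff (X : ℝ≥0 → Ω → S) (δ : ℝ≥0 → ℝ≥0) (f : S → ℝ≥0) (τ : ℝ≥0∞) (ω : Ω) :
    ℝ≥0∞ :=
  if τ = ∞ then limsup (fun t : ℝ≥0 => ((δ t * f (X t ω) : ℝ≥0) : ℝ≥0∞)) atTop
  else ((δ τ.toNNReal * f (X τ.toNNReal ω) : ℝ≥0) : ℝ≥0∞)

/-- The expected payoff `J(x, R) = 𝔼ˣ[δ(ρ(x,R)) f(X_{ρ(x,R)})] ∈ [0, ∞]` of continuing until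
`R` is reached. -/
def J (X : ℝ≥0 → Ω → S) (P : Kernel S Ω) (δ : ℝ≥0 → ℝ≥0) (f : S → ℝ≥0) (x : S) (R : Set S) :
    ℝ≥0∞ :=
  ∫⁻ ω, discountedPayoff X δ f (rho X R ω) ω ∂(P x)

/-- The stopping region `S_R`. -/
def stopRegion (X : ℝ≥0 → Ω → S) (P : Kernel S Ω) (δ : ℝ≥0 → ℝ≥0) (f : S → ℝ≥0) (R : Set S) :
    Set S :=
  {x | J X P δ f x R < f x}

/-- The indifference region `I_R`. -/
def indiffRegion (X : ℝ≥0 → Ω → S) (P : Kernel S Ω) (δ : ℝ≥0 → ℝ≥0) (f : S → ℝ≥0) (R : Set S) :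
    Set S :=
  {x | (f x : ℝ≥0∞) = J X P δ f x R}

/-- The continuation region `C_R`. -/
def contRegion (X : ℝ≥0 → Ω → S) (P : Kernel S Ω) (δ : ℝ≥0 → ℝ≥0) (f : S → ℝ≥0) (R : Set S) :
    Set S :=
  {x | f x < J X P δ f x R}

/-- The best response `Θ(R) = S_R ∪ (I_R ∩ R)`. -/
def Theta (X : ℝ≥0 → Ω → S) (P : Kernel S Ω) (δ : ℝ≥0 → ℝ≥0) (f : S → ℝ≥0) (R : Set S) :
    Set S :=
  stopRegion X P δ f R ∪ (indiffRegion X P δ f R ∩ R)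

/-- An equilibrium is a Borel set `R` with `Θ(R) = R`. -/
def IsEquilibrium (X : ℝ≥0 → Ω → S) (P : Kernel S Ω) (δ : ℝ≥0 → ℝ≥0) (f : S → ℝ≥0)
    (R : Set S) : Prop :=
  MeasurableSet R ∧ Theta X P δ f R = R

/-- The value `V(x, R) = f(x) ∨ J(x, R)`. -/
def V (X : ℝ≥0 → Ω → S) (P : Kernel S Ω) (δ : ℝ≥0 → ℝ≥0) (f : S → ℝ≥0) (x : S) (R : Set S) :
    ℝ≥0∞ :=
  max (f x : ℝ≥0∞) (J X P δ f x R)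

/-- An optimal equilibrium dominates every equilibrium at every starting point. -/
def IsOptimalEquilibrium (X : ℝ≥0 → Ω → S) (P : Kernel S Ω) (δ : ℝ≥0 → ℝ≥0) (f : S → ℝ≥0)
    (R : Set S) : Prop :=
  IsEquilibrium X P δ f R ∧
    ∀ T, IsEquilibrium X P δ f T → ∀ x, V X P δ f x T ≤ V X P δ f x R

/-- `R*`, the intersection of all closed equilibria. -/
def Rstar (X : ℝ≥0 → Ω → S) (P : Kernel S Ω) (δ : ℝ≥0 → ℝ≥0) (f : S → ℝ≥0) : Set S :=
  ⋂₀ {R | IsEquilibrium X P δ f R ∧ IsClosed R}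

open Classical in
/-- `sup {y ∈ R : y < x}`, and `inf S` (possibly `-∞`) if there is no such `y`. -/
def leftEnd (R : Set S) (x : S) : EReal :=
  if ∃ y ∈ R, y < x then sSup {e : EReal | ∃ y ∈ R, y < x ∧ e = ((y : ℝ) : EReal)}
  else sInf {e : EReal | ∃ y : S, e = ((y : ℝ) : EReal)}

open Classical in
/-- `inf {y ∈ R : y > x}`, and `sup S` (possibly `∞`) if there is no such `y`. -/
def rightEnd (R : Set S) (x : S) : EReal :=
  if ∃ y ∈ R, x < y then sInf {e : EReal | ∃ y ∈ R, x < y ∧ e = ((y : ℝ) : EReal)}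
  else sSup {e : EReal | ∃ y : S, e = ((y : ℝ) : EReal)}

/-- The open interval between `leftEnd R x` and `rightEnd R x`. -/
def gap (R : Set S) (x : S) : Set S :=
  {y | leftEnd R x < ((y : ℝ) : EReal) ∧ ((y : ℝ) : EReal) < rightEnd R x}

end NonExpStopping

end

open NonExpStopping

open MeasureTheory ProbabilityTheory Filter Set
open scoped NNReal ENNReal Topology

noncomputable section

namespace NonExpStopping

variable {S : Set ℝ} {Ω : Type*} [MeasurableSpace Ω]

/-! Write `R` for `R*`, `T` for the closed optimal equilibrium and `G` for the gap; `R ⊆ T` because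
`T` is one of the closed equilibria being intersected. Two optimal equilibria have the same value,
so `J(·, R) = f` on `T \ R` and `J(·, R) = J(·, T)` off `T`.

Suppose `G` meets both `T` and its complement, and `J(·, R)` is nonzero somewhere on `G`. From a
point `a ∈ G \ T`, stopping at `ρ(T)` earns a payoff which, by the strong Markov property, has the
same mean as continuing to `R` but discounting the two legs separately. Since `δ(s)δ(t) < δ(s+t)`,
discounting the whole journey at once is worth more, strictly so when `T` is first met inside `G`
and the continuation still pays. Regularity gives that event positive probability: inside `G` every
point is reached from every other without leaving `G` (`reachWithin_not_ae`), and therefore `J(·,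
R)` is positive on all of `G` (`exists_mul_J_le`). Hence `J(a, T) < J(a, R)` (`J_lt_J`),
contradicting equality off `T`. The first two claims follow.

In the third case `f` and `J(·, R)` both vanish on `G`. A path that enters `G` before `R` then earns
nothing whether or not it stops there, so adding `A` leaves `J` unchanged (`J_union_eq`), and the
points of `A` are indifferent. -/

/-- The space of continuous paths in `S`, with the σ-algebra generated by the coordinates. -/
abbrev ContPath (S : Set ℝ) := {w : ℝ≥0 → S // Continuous w}

/-- The coordinate process on path space. -/
def coord (t : ℝ≥0) (w : ContPath S) : S := w.1 t

/-- The path seen from time `t` on. -/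
def shift (t : ℝ≥0) (w : ContPath S) : ContPath S :=
  ⟨fun s => w.1 (t + s), w.2.comp (continuous_const.add continuous_id)⟩

lemma measurable_coord (t : ℝ≥0) : Measurable (coord t : ContPath S → S) :=
  (measurable_pi_apply t).comp measurable_subtype_coe

lemma continuous_coord (w : ContPath S) : Continuous fun t => coord t w := w.2

@[simp] lemma coord_shift (s t : ℝ≥0) (w : ContPath S) :
    coord s (shift t w) = coord (t + s) w := rfl

lemma measurable_uncurry_coord : Measurable (Function.uncurry (coord (S := S))) :=
  measurable_uncurry_of_continuous_of_measurable continuous_coord measurable_coord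

/-! ### Hitting times of closed sets by continuous paths. -/

section Rho

variable {Ω' : Type*} {Y : ℝ≥0 → Ω' → S} {R : Set S} {ω : Ω'}

lemma rho_lt_iff {c : ℝ≥0∞} :
    rho Y R ω < c ↔ ∃ t : ℝ≥0, 0 < t ∧ Y t ω ∈ R ∧ (t : ℝ≥0∞) < c := by
  simp only [rho, iInf_lt_iff]
  constructor
  · rintro ⟨t, ⟨h1, h2⟩, h3⟩; exact ⟨t, h1, h2, h3⟩
  · rintro ⟨t, h1, h2, h3⟩; exact ⟨t, ⟨h1, h2⟩, h3⟩

lemma rho_le {t : ℝ≥0} (ht : 0 < t) (h : Y t ω ∈ R) : rho Y R ω ≤ t :=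
  iInf₂_le t ⟨ht, h⟩

lemma rho_anti {T : Set S} (h : R ⊆ T) : rho Y T ω ≤ rho Y R ω :=
  le_iInf₂ fun _ ht => rho_le ht.1 (h ht.2)

lemma mem_of_rho_eq (hR : IsClosed R) (hc : Continuous fun t => Y t ω) {t : ℝ≥0}
    (h : rho Y R ω = t) : Y t ω ∈ R := by
  by_contra hn
  have hmem : {s | Y s ω ∈ Rᶜ} ∈ 𝓝 t := (hR.isOpen_compl.preimage hc).mem_nhds hn
  obtain ⟨u, hu, hsub⟩ := exists_Ico_subset_of_mem_nhds hmem (exists_gt t)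
  have : rho Y R ω < u := by rw [h]; exact_mod_cast hu
  obtain ⟨s, hs, hsR, hsu⟩ := rho_lt_iff.1 this
  have hts : t ≤ s := by
    have := rho_le hs hsR
    rw [h] at this
    exact_mod_cast this
  exact hsub ⟨hts, by exact_mod_cast hsu⟩ hsR

lemma rho_pos (hR : IsClosed R) (hc : Continuous fun t => Y t ω) (h : Y 0 ω ∉ R) :
    0 < rho Y R ω := by
  rw [pos_iff_ne_zero]
  intro h0
  exact h (mem_of_rho_eq hR hc (by simpa using h0))

/-- By compactness and continuity, a path meets the closed set during `[a, b]` iff its distance to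
the set becomes arbitrarily small along a countable dense set of times. -/
lemma measurableSet_exists_mem_Icc (m : MeasurableSpace Ω') (hR : IsClosed R)
    (hc : ∀ ω, Continuous fun t => Y t ω) {a b : ℝ≥0}
    (hm : ∀ t ∈ Icc a b, Measurable[m] (Y t)) :
    MeasurableSet[m] {ω | ∃ t ∈ Icc a b, Y t ω ∈ R} := by
  rcases isEmpty_or_nonempty (Icc a b) with he | hne
  · have : {ω | ∃ t ∈ Icc a b, Y t ω ∈ R} = ∅ := by
      ext ω
      simp only [mem_ofPred_eq, mem_empty_iff_false, iff_false]
      rintro ⟨t, ht, -⟩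
      exact he.false ⟨t, ht⟩
    rw [this]; exact MeasurableSet.empty
  let d : ℕ → Icc a b := TopologicalSpace.denseSeq (Icc a b)
  have hd : DenseRange d := TopologicalSpace.denseRange_denseSeq _
  have key : {ω | ∃ t ∈ Icc a b, Y t ω ∈ R} =
      ⋂ n : ℕ, ⋃ k : ℕ, {ω | Metric.infEDist (Y (d k) ω) R < ((n : ℝ≥0∞) + 1)⁻¹} := by
    ext ω
    simp only [mem_ofPred_eq, mem_iInter, mem_iUnion]
    have hcont : Continuous fun t : Icc a b => Metric.infEDist (Y t ω) R :=
      Metric.continuous_infEDist.comp ((hc ω).comp continuous_subtype_val)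
    constructor
    · rintro ⟨t, ht, htR⟩ n
      have hopen : IsOpen {t : Icc a b | Metric.infEDist (Y t ω) R < ((n : ℝ≥0∞) + 1)⁻¹} :=
        isOpen_lt hcont continuous_const
      have : (⟨t, ht⟩ : Icc a b) ∈
          {t : Icc a b | Metric.infEDist (Y t ω) R < ((n : ℝ≥0∞) + 1)⁻¹} := by
        simp only [mem_ofPred_eq, Metric.infEDist_zero_of_mem htR, ENNReal.inv_pos]
        exact ENNReal.add_ne_top.2 ⟨ENNReal.natCast_ne_top n, ENNReal.one_ne_top⟩
      exact hd.exists_mem_open hopen ⟨_, this⟩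
    · intro h
      obtain ⟨t, -, ht⟩ := isCompact_univ.exists_isMinOn univ_nonempty hcont.continuousOn
      refine ⟨t, t.2, ?_⟩
      rw [Metric.mem_iff_infEDist_zero_of_closed hR, ← nonpos_iff_eq_zero]
      refine le_of_forall_gt fun c hc => ?_
      obtain ⟨n, hn⟩ := ENNReal.exists_inv_nat_lt hc.ne'
      obtain ⟨k, hk⟩ := h n
      calc _ ≤ Metric.infEDist (Y (d k) ω) R := ht (mem_univ (d k))
        _ < _ := hk
        _ ≤ (n : ℝ≥0∞)⁻¹ := ENNReal.inv_le_inv.2 le_self_add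
        _ < c := hn
  rw [key]
  refine MeasurableSet.iInter fun n => MeasurableSet.iUnion fun k => ?_
  have h1 : Measurable[m] fun ω => Metric.infEDist (Y (d k) ω) R :=
    (Metric.continuous_infEDist.measurable).comp (hm _ (d k).2)
  exact h1 measurableSet_Iio

lemma measurableSet_rho_lt (m : MeasurableSpace Ω') (hR : IsClosed R)
    (hc : ∀ ω, Continuous fun t => Y t ω) {b : ℝ≥0}
    (hm : ∀ t ≤ b, Measurable[m] (Y t)) :
    MeasurableSet[m] {ω | rho Y R ω < b} := by
  obtain ⟨D, hDc, hD⟩ := TopologicalSpace.exists_countable_dense ℝ≥0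
  have key : {ω | rho Y R ω < b} =
      ⋃ p ∈ D, ⋃ q ∈ D, ⋃ (_ : 0 < p ∧ q < b), {ω | ∃ t ∈ Icc p q, Y t ω ∈ R} := by
    ext ω
    simp only [mem_ofPred_eq, mem_iUnion, rho_lt_iff, exists_prop]
    constructor
    · rintro ⟨t, h0, htR, htb⟩
      obtain ⟨p, hpD, hp⟩ := hD.exists_between h0
      obtain ⟨q, hqD, hq⟩ := hD.exists_between (ENNReal.coe_lt_coe.1 htb)
      exact ⟨p, hpD, q, hqD, ⟨hp.1, hq.2⟩, t, ⟨hp.2.le, hq.1.le⟩, htR⟩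
    · rintro ⟨p, -, q, -, ⟨hp, hq⟩, t, ht, htR⟩
      exact ⟨t, hp.trans_le ht.1, htR, by exact_mod_cast ht.2.trans_lt hq⟩
  rw [key]
  refine MeasurableSet.biUnion hDc fun p _ => MeasurableSet.biUnion hDc fun q _ =>
    MeasurableSet.iUnion fun h => ?_
  exact measurableSet_exists_mem_Icc m hR hc fun t ht => hm t (ht.2.trans h.2.le)

lemma measurable_rho [MeasurableSpace Ω'] (hR : IsClosed R)
    (hc : ∀ ω, Continuous fun t => Y t ω) (hm : ∀ t, Measurable (Y t)) :
    Measurable (rho Y R) := by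
  refine measurable_of_Iio fun c => ?_
  induction c with
  | top =>
    have : rho Y R ⁻¹' Iio ∞ = ⋃ n : ℕ, {ω | rho Y R ω < ((n : ℝ≥0) : ℝ≥0∞)} := by
      ext ω
      simp only [mem_preimage, mem_Iio, mem_iUnion, mem_ofPred_eq]
      constructor
      · intro h
        obtain ⟨n, hn⟩ := ENNReal.exists_nat_gt h.ne
        exact ⟨n, by simpa using hn⟩
      · rintro ⟨n, hn⟩
        exact hn.trans ENNReal.coe_lt_top
    rw [this]
    exact MeasurableSet.iUnion fun n => measurableSet_rho_lt _ hR hc fun t _ => hm t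
  | coe b => exact measurableSet_rho_lt _ hR hc fun t _ => hm t

end Rho

/-- Strictness matters: at `t = ρ(R)` the shifted hitting time looks for a visit after time `0` and
need not vanish. -/
lemma rho_shift {R : Set S} {w : ContPath S} {t : ℝ≥0} (h : (t : ℝ≥0∞) < rho coord R w) :
    rho coord R w = t + rho coord R (shift t w) := by
  apply le_antisymm
  · by_contra! hlt
    obtain ⟨s, hs, hsR, hs'⟩ := rho_lt_iff.1 (lt_tsub_iff_left.2 hlt)
    have h1 := lt_tsub_iff_left.1 hs'
    have h2 := rho_le (Y := coord) (t := t + s) (by positivity) (by simpa using hsR)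
    rw [ENNReal.coe_add] at h2
    exact h1.not_ge h2
  · refine le_iInf₂ fun s hs => ?_
    have hts : t < s := by exact_mod_cast h.trans_le (rho_le hs.1 hs.2)
    have h1 : rho coord R (shift t w) ≤ ((s - t : ℝ≥0) : ℝ≥0∞) :=
      rho_le (tsub_pos_of_lt hts) (by simpa [add_tsub_cancel_of_le hts.le] using hs.2)
    calc _ ≤ (t : ℝ≥0∞) + ((s - t : ℝ≥0) : ℝ≥0∞) := by gcongr
      _ = s := by rw [← ENNReal.coe_add, add_tsub_cancel_of_le hts.le]

lemma measurable_rho_coord {R : Set S} (hR : IsClosed R) :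
    Measurable (rho (coord (S := S)) R) :=
  measurable_rho hR continuous_coord measurable_coord

lemma measurable_coord_comp {Ω' : Type*} [MeasurableSpace Ω'] {τ : Ω' → ℝ≥0} {g : Ω' → ContPath S}
    (hτ : Measurable τ) (hg : Measurable g) : Measurable fun ω => coord (τ ω) (g ω) :=
  measurable_uncurry_coord.comp (hτ.prodMk hg)

lemma measurable_shift_comp {Ω' : Type*} [MeasurableSpace Ω'] {τ : Ω' → ℝ≥0} {g : Ω' → ContPath S}
    (hτ : Measurable τ) (hg : Measurable g) : Measurable fun ω => shift (τ ω) (g ω) := by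
  refine Measurable.subtype_mk (measurable_pi_lambda _ fun s => ?_)
  exact measurable_coord_comp (hτ.add_const s) hg

open Classical in
/-- The discounted payoff collected at the hitting time of `R`, and `0` if `R` is never hit. -/
def hitPayoff (δ : ℝ≥0 → ℝ≥0) (f : S → ℝ≥0) (R : Set S) (w : ContPath S) : ℝ≥0∞ :=
  if rho coord R w = ∞ then 0
  else ((δ (rho coord R w).toNNReal * f (coord (rho coord R w).toNNReal w) : ℝ≥0) : ℝ≥0∞)

lemma measurable_hitPayoff {δ : ℝ≥0 → ℝ≥0} (hδ : Measurable δ) {f : S → ℝ≥0} (hf : Measurable f)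
    {R : Set S} (hR : IsClosed R) : Measurable (hitPayoff δ f R) := by
  have h1 := measurable_rho_coord hR
  refine Measurable.ite (h1 (measurableSet_singleton _)) measurable_const ?_
  exact ((hδ.comp h1.ennreal_toNNReal).mul
    (hf.comp (measurable_coord_comp h1.ennreal_toNNReal measurable_id))).coe_nnreal_ennreal

lemma hitPayoff_of_eq {δ : ℝ≥0 → ℝ≥0} {f : S → ℝ≥0} {R : Set S} {w : ContPath S} {t : ℝ≥0}
    (h : rho coord R w = t) : hitPayoff δ f R w = ((δ t * f (coord t w) : ℝ≥0) : ℝ≥0∞) := by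
  simp [hitPayoff, h]

lemma hitPayoff_of_top {δ : ℝ≥0 → ℝ≥0} {f : S → ℝ≥0} {R : Set S} {w : ContPath S}
    (h : rho coord R w = ∞) : hitPayoff δ f R w = 0 := by
  simp [hitPayoff, h]

/-! ### Order and topology of the gaps. -/

section Gap

variable {R : Set S} {x : S}

lemma notMem_of_mem_gap (hx : x ∉ R) {y : S} (hy : y ∈ gap R x) : y ∉ R := by
  intro hyR
  rcases lt_trichotomy y x with h | rfl | h
  · have hex : ∃ y ∈ R, y < x := ⟨y, hyR, h⟩
    have h1 := hy.1
    rw [leftEnd, if_pos hex] at h1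
    exact h1.not_ge (le_sSup ⟨y, hyR, h, rfl⟩)
  · exact hx hyR
  · have hex : ∃ y ∈ R, x < y := ⟨y, hyR, h⟩
    have h1 := hy.2
    rw [rightEnd, if_pos hex] at h1
    exact h1.not_ge (sInf_le ⟨y, hyR, h, rfl⟩)

lemma mem_interior_of_mem_gap (hS : S.OrdConnected) {y : S} (hy : y ∈ gap R x) :
    (y : ℝ) ∈ interior S := by
  have hl : ∃ a : S, a < y := by
    have h1 := hy.1
    rw [leftEnd] at h1
    split_ifs at h1 with hex
    · obtain ⟨a, haR, hax⟩ := hex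
      refine ⟨a, ?_⟩
      have : ((a : ℝ) : EReal) < ((y : ℝ) : EReal) :=
        (le_sSup (by exact ⟨a, haR, hax, rfl⟩)).trans_lt h1
      exact_mod_cast this
    · obtain ⟨_, ⟨a, rfl⟩, ha⟩ := sInf_lt_iff.1 h1
      exact ⟨a, by exact_mod_cast ha⟩
  have hr : ∃ b : S, y < b := by
    have h1 := hy.2
    rw [rightEnd] at h1
    split_ifs at h1 with hex
    · obtain ⟨a, haR, hax⟩ := hex
      refine ⟨a, ?_⟩
      have : ((y : ℝ) : EReal) < ((a : ℝ) : EReal) :=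
        h1.trans_le (sInf_le (by exact ⟨a, haR, hax, rfl⟩))
      exact_mod_cast this
    · obtain ⟨_, ⟨a, rfl⟩, ha⟩ := lt_sSup_iff.1 h1
      exact ⟨a, by exact_mod_cast ha⟩
  obtain ⟨a, ha⟩ := hl
  obtain ⟨b, hb⟩ := hr
  exact mem_interior_iff_mem_nhds.2
    (mem_of_superset (Icc_mem_nhds (show (a : ℝ) < y from ha) (show (y : ℝ) < b from hb))
      (hS.out a.2 b.2))

lemma isOpen_gap : IsOpen (gap R x) := by
  have hc : Continuous fun y : S => ((y : ℝ) : EReal) :=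
    continuous_coe_real_ereal.comp continuous_subtype_val
  exact (isOpen_lt continuous_const hc).inter (isOpen_lt hc continuous_const)

lemma gap_ordConnected : (gap R x).OrdConnected := by
  refine ⟨fun a ha b hb c hc => ⟨ha.1.trans_le ?_, lt_of_le_of_lt ?_ hb.2⟩⟩
  · exact_mod_cast (show (a : ℝ) ≤ c from hc.1)
  · exact_mod_cast (show (c : ℝ) ≤ b from hc.2)

end Gap

/-! ### Reaching a point inside an open interval. -/

/-- The paths that reach `z` in finite time without leaving `G` before. -/
def reachWithin (G : Set S) (z : S) : Set (ContPath S) :=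
  {w | ∃ t, coord t w = z ∧ ∀ s ≤ t, coord s w ∈ G}

/-- After the last visit `σ` to `y` before reaching `z`, the path stays between `y` and `z`, hence
in `G`. As `σ` is not a stopping time, it is replaced by the first visit to `y` after some `q ∈ D`
so close to `σ` that the path remains in `G` on `(q, σ]`. -/
lemma reachWithin_of_hit {G : Set S} (hGo : IsOpen G) (hG : G.OrdConnected) {D : Set ℝ≥0}
    (hD : Dense D) {y z : S} (hy : y ∈ G) (hz : z ∈ G) {w : ContPath S} (h0 : coord 0 w = y)
    {t : ℝ≥0} (ht : coord t w = z) :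
    w ∈ reachWithin G z ∨ ∃ q ∈ D, ∃ r : ℝ≥0, rho coord {y} (shift q w) = r ∧
      shift r (shift q w) ∈ reachWithin G z := by
  have hc := continuous_coord w
  obtain ⟨σ, ⟨hσ, hσy⟩, hσmax⟩ := (isCompact_Icc.inter_right
    ((isClosed_singleton (x := y)).preimage hc) : IsCompact (Icc 0 t ∩ _)).exists_isGreatest
    ⟨0, ⟨le_rfl, zero_le⟩, h0⟩
  obtain ⟨u, ⟨hu, huz⟩, humin⟩ := (isCompact_Icc.inter_right
    ((isClosed_singleton (x := z)).preimage hc) : IsCompact (Icc σ t ∩ _)).exists_isLeast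
    ⟨t, ⟨hσ.2, le_rfl⟩, ht⟩
  have hσy' : coord σ w = y := hσy
  have huz' : coord u w = z := huz
  have hcr : Continuous fun s => (coord s w : ℝ) := continuous_subtype_val.comp hc
  have hmem : ∀ s ∈ Icc σ u, coord s w ∈ G := by
    intro s hs
    suffices h : (coord s w : ℝ) ∈ uIcc (y : ℝ) z by
      rcases le_total y z with hyz | hyz
      · rw [uIcc_of_le (show (y : ℝ) ≤ z from hyz)] at h
        exact hG.out hy hz h
      · rw [uIcc_of_ge (show (z : ℝ) ≤ y from hyz)] at h
        exact hG.out hz hy h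
    by_contra hn
    -- A value outside the segment forces a crossing of `y` after `σ` or of `z` before `u`, against
    -- the choice of `σ` as last and `u` as first.
    have hcases : (y : ℝ) ∈ uIcc (coord s w : ℝ) z ∨ (z : ℝ) ∈ uIcc (y : ℝ) (coord s w) := by
      simp only [mem_uIcc] at hn ⊢
      grind
    rcases hcases with h | h
    · rw [← huz'] at h
      obtain ⟨v, hv, hvy⟩ := intermediate_value_uIcc (a := s) (b := u) hcr.continuousOn h
      rw [uIcc_of_le hs.2] at hv
      have hvσ : v ≤ σ := hσmax ⟨⟨zero_le, hv.2.trans hu.2⟩, Subtype.ext hvy⟩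
      have : s = σ := le_antisymm (hv.1.trans hvσ) hs.1
      rw [this, hσy'] at hn
      exact hn left_mem_uIcc
    · rw [← hσy'] at h
      obtain ⟨v, hv, hvz⟩ := intermediate_value_uIcc (a := σ) (b := s) hcr.continuousOn h
      rw [uIcc_of_le hs.1] at hv
      have huv : u ≤ v := humin ⟨⟨hv.1, hv.2.trans (hs.2.trans hu.2)⟩, Subtype.ext hvz⟩
      have : s = u := le_antisymm hs.2 (huv.trans hv.2)
      rw [this, huz'] at hn
      exact hn right_mem_uIcc
  rcases eq_or_lt_of_le (zero_le (a := σ)) with h | hpos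
  · left
    exact ⟨u, huz', fun s hs => hmem s ⟨h ▸ zero_le, hs⟩⟩
  · right
    have hnhds : {s | coord s w ∈ G} ∈ 𝓝 σ :=
      (hGo.preimage hc).mem_nhds (by simpa [hσy'] using hy)
    obtain ⟨l, hl, hlsub⟩ := exists_Ioc_subset_of_mem_nhds hnhds ⟨0, hpos⟩
    obtain ⟨q, hqD, hq⟩ := hD.exists_between hl
    have hle : rho coord {y} (shift q w) ≤ ((σ - q : ℝ≥0) : ℝ≥0∞) :=
      rho_le (tsub_pos_of_lt hq.2) (by simp [add_tsub_cancel_of_le hq.2.le, hσy'])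
    lift rho coord {y} (shift q w) to ℝ≥0 using ne_top_of_le_ne_top ENNReal.coe_ne_top hle with r hr
    have hle' : q + r ≤ σ := by
      have : r ≤ σ - q := by exact_mod_cast hle
      calc q + r ≤ q + (σ - q) := by gcongr
        _ = σ := add_tsub_cancel_of_le hq.2.le
    refine ⟨q, hqD, r, hr.symm, u - (q + r), ?_, fun s hs => ?_⟩
    · simp only [coord_shift]
      rw [← add_assoc, add_tsub_cancel_of_le (hle'.trans hu.1), huz']
    · simp only [coord_shift]
      rw [← add_assoc]
      rcases le_total (q + r + s) σ with h | h
      · exact hlsub ⟨hq.1.trans_le (by rw [add_assoc]; exact le_self_add), h⟩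
      · refine hmem _ ⟨h, ?_⟩
        calc q + r + s ≤ q + r + (u - (q + r)) := by gcongr
          _ = u := add_tsub_cancel_of_le (hle'.trans hu.1)

/-! ### The strong Markov property on path space. -/

namespace IsContinuousStrongMarkov

variable {X : ℝ≥0 → Ω → S} {P : Kernel S Ω} (hX : IsContinuousStrongMarkov X P)
include hX

/-- The trajectory of the process as a point of path space. -/
def path (ω : Ω) : ContPath S := ⟨fun t => X t ω, hX.continuous_paths ω⟩

@[simp] lemma coord_path (t : ℝ≥0) (ω : Ω) : coord t (hX.path ω) = X t ω := rfl

lemma rho_path (R : Set S) (ω : Ω) : rho coord R (hX.path ω) = rho X R ω := rfl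

lemma measurable_path : Measurable hX.path :=
  Measurable.subtype_mk (measurable_pi_lambda _ fun t => (hX.stronglyMeasurable t).measurable)

/-- Whether `ρ(R) = 0` depends on the immediate future; right-continuity of the filtration makes it
enough to test the events `ρ(R) < i`. -/
lemma isStoppingTime_rho {R : Set S} (hR : IsClosed R) :
    IsStoppingTime (Filtration.natural X hX.stronglyMeasurable).rightCont
      (fun ω => (rho X R ω : WithTop ℝ≥0)) := by
  refine isStoppingTime_of_measurableSet_lt_of_isRightContinuous fun i => ?_
  refine Filtration.le_rightCont _ i _ ?_
  refine measurableSet_rho_lt _ hR hX.continuous_paths fun t ht => ?_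
  exact ((Filtration.stronglyAdapted_natural hX.stronglyMeasurable t).mono
    ((Filtration.natural X hX.stronglyMeasurable).mono ht)).measurable

lemma setLIntegral_shift {τ : Ω → WithTop ℝ≥0}
    (hτ : IsStoppingTime (Filtration.natural X hX.stronglyMeasurable).rightCont τ)
    {A : Set Ω} (hA : MeasurableSet[hτ.measurableSpace] A) {G : ContPath S → ℝ≥0∞}
    (hG : Measurable G) (x : S) :
    ∫⁻ ω in A ∩ {ω | τ ω ≠ ⊤}, G (shift ((τ ω).untopD 0) (hX.path ω)) ∂(P x) =
      ∫⁻ ω in A ∩ {ω | τ ω ≠ ⊤},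
        ∫⁻ ω', G (hX.path ω') ∂(P (X ((τ ω).untopD 0) ω)) ∂(P x) := by
  have hτm : Measurable fun ω => (τ ω).untopD 0 :=
    ((WithTop.measurable_untopD 0).comp hτ.measurable).mono hτ.measurableSpace_le le_rfl
  have hsh : Measurable fun ω => shift ((τ ω).untopD 0) (hX.path ω) :=
    measurable_shift_comp hτm hX.measurable_path
  have hXτ : Measurable fun ω => X ((τ ω).untopD 0) ω :=
    measurable_coord_comp hτm hX.measurable_path
  have hQ : Measurable fun ω => (P.map hX.path) (X ((τ ω).untopD 0) ω) :=
    (P.map hX.path).measurable.comp hXτ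
  have key : ((P x).restrict (A ∩ {ω | τ ω ≠ ⊤})).map
        (fun ω => shift ((τ ω).untopD 0) (hX.path ω)) =
      ((P x).restrict (A ∩ {ω | τ ω ≠ ⊤})).bind
        (fun ω => (P.map hX.path) (X ((τ ω).untopD 0) ω)) := by
    ext B hB
    rw [Measure.map_apply hsh hB, Measure.restrict_apply (hsh hB),
      Measure.bind_apply hB hQ.aemeasurable]
    obtain ⟨B', hB', rfl⟩ := hB
    have h := hX.strong_markov τ hτ A hA B' hB' x
    rw [inter_comm] at h
    refine Eq.trans ?_ (h.trans ?_)
    · rfl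
    · refine lintegral_congr fun ω => ?_
      rw [Kernel.map_apply' _ hX.measurable_path _ (measurable_subtype_coe hB')]
      rfl
  calc _ = ∫⁻ w, G w ∂(((P x).restrict (A ∩ {ω | τ ω ≠ ⊤})).map
        (fun ω => shift ((τ ω).untopD 0) (hX.path ω))) := (lintegral_map hG hsh).symm
    _ = _ := by
      rw [key, Measure.lintegral_bind hQ.aemeasurable hG.aemeasurable]
      refine lintegral_congr fun ω => ?_
      rw [Kernel.map_apply _ hX.measurable_path, lintegral_map hG hX.measurable_path]

lemma measurable_lintegral_path {G : ContPath S → ℝ≥0∞} (hG : Measurable G) :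
    Measurable fun z => ∫⁻ ω, G (hX.path ω) ∂(P z) :=
  (hG.comp hX.measurable_path).lintegral_kernel

/-- The strong Markov property, for functionals of the future and weights known at time `τ`. -/
theorem setLIntegral_mul_shift {τ : Ω → WithTop ℝ≥0}
    (hτ : IsStoppingTime (Filtration.natural X hX.stronglyMeasurable).rightCont τ)
    {c : Ω → ℝ≥0∞} (hc : Measurable[hτ.measurableSpace] c) {G : ContPath S → ℝ≥0∞}
    (hG : Measurable G) (x : S) :
    ∫⁻ ω in {ω | τ ω ≠ ⊤}, c ω * G (shift ((τ ω).untopD 0) (hX.path ω)) ∂(P x) =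
      ∫⁻ ω in {ω | τ ω ≠ ⊤},
        c ω * ∫⁻ ω', G (hX.path ω') ∂(P (X ((τ ω).untopD 0) ω)) ∂(P x) := by
  have hle := hτ.measurableSpace_le
  have hτm : Measurable fun ω => (τ ω).untopD 0 := ((WithTop.measurable_untopD 0).comp hτ.measurable).mono hle le_rfl
  have hg₁ : Measurable fun ω => G (shift ((τ ω).untopD 0) (hX.path ω)) :=
    hG.comp (measurable_shift_comp hτm hX.measurable_path)
  have hg₂ : Measurable fun ω => ∫⁻ ω', G (hX.path ω') ∂(P (X ((τ ω).untopD 0) ω)) :=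
    (hX.measurable_lintegral_path hG).comp (measurable_coord_comp hτm hX.measurable_path)
  have hcm : Measurable c := hc.mono hle le_rfl
  set μ := (P x).restrict {ω | τ ω ≠ ⊤}
  -- The two densities have equal integrals over events known at time `τ`, so they define the same
  -- measure on that σ-algebra; integrating `c` against it gives the weighted identity.
  have key : (μ.withDensity fun ω => G (shift ((τ ω).untopD 0) (hX.path ω))).trim hle =
      (μ.withDensity fun ω => ∫⁻ ω', G (hX.path ω') ∂(P (X ((τ ω).untopD 0) ω))).trim hle := by
    refine @Measure.ext _ hτ.measurableSpace _ _ fun A hA => ?_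
    rw [trim_measurableSet_eq hle hA, trim_measurableSet_eq hle hA,
      withDensity_apply _ (hle _ hA), withDensity_apply _ (hle _ hA),
      Measure.restrict_restrict (hle _ hA)]
    exact hX.setLIntegral_shift hτ hA hG x
  have h := congrArg (fun ν => @lintegral _ hτ.measurableSpace ν c) key
  simp only [lintegral_trim hle hc] at h
  rw [lintegral_withDensity_eq_lintegral_mul _ hg₁ hcm,
    lintegral_withDensity_eq_lintegral_mul _ hg₂ hcm] at h
  simpa [mul_comm] using h

end IsContinuousStrongMarkov

/-- Expressing the event through hitting times makes it measurable. The first alternative covers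
arrival at time `0`, which `rho` ignores. -/
lemma mem_reachWithin_iff {G : Set S} (hG : IsOpen G) {z : S} (hz : z ∈ G) {w : ContPath S} :
    w ∈ reachWithin G z ↔
      coord 0 w = z ∨ (coord 0 w ∈ G ∧ rho coord {z} w < rho coord Gᶜ w) := by
  have hc := continuous_coord w
  constructor
  · rintro ⟨t, ht, htG⟩
    rcases eq_or_ne t 0 with rfl | h0
    · exact Or.inl ht
    refine Or.inr ⟨htG 0 zero_le, ?_⟩
    have h1 : rho coord {z} w ≤ t := rho_le (pos_iff_ne_zero.2 h0) ht
    by_contra! h2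
    have h3 := h2.trans h1
    lift rho coord Gᶜ w to ℝ≥0 using ne_top_of_le_ne_top ENNReal.coe_ne_top h3 with r hr
    exact mem_of_rho_eq hG.isClosed_compl hc hr.symm (htG r (by exact_mod_cast h3))
  · rintro (h | ⟨h0, hlt⟩)
    · exact ⟨0, h, fun s hs => by rw [nonpos_iff_eq_zero.1 hs, h]; exact hz⟩
    · lift rho coord {z} w to ℝ≥0 using hlt.ne_top with r hr
      refine ⟨r, mem_of_rho_eq isClosed_singleton hc hr.symm, fun s hs => ?_⟩
      by_contra hsG
      rcases eq_or_ne s 0 with rfl | hs0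
      · exact hsG h0
      have h1 : rho coord Gᶜ w ≤ s := rho_le (pos_iff_ne_zero.2 hs0) hsG
      have h2 : (s : ℝ≥0∞) ≤ r := by exact_mod_cast hs
      exact (hlt.trans_le (h1.trans h2)).false

lemma measurableSet_reachWithin {G : Set S} (hG : IsOpen G) {z : S} (hz : z ∈ G) :
    MeasurableSet (reachWithin G z) := by
  have : reachWithin G z = {w | coord 0 w = z} ∪
      ({w | coord 0 w ∈ G} ∩ {w | rho coord {z} w < rho coord Gᶜ w}) :=
    Set.ext fun w => mem_reachWithin_iff hG hz
  rw [this]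
  exact (measurable_coord 0 (measurableSet_singleton z)).union
    ((measurable_coord 0 hG.measurableSet).inter
      (measurableSet_lt (measurable_rho_coord isClosed_singleton)
        (measurable_rho_coord hG.isClosed_compl)))

/-! ### Discounted payoffs along a single path. -/

section Payoff

variable {δ : ℝ≥0 → ℝ≥0} {f : S → ℝ≥0} {R : Set S} {w : ContPath S} {t : ℝ≥0}

lemma hitPayoff_of_lt_rho (h : (t : ℝ≥0∞) < rho coord R w) {r : ℝ≥0}
    (hr : rho coord R (shift t w) = r) :
    0 < r ∧ hitPayoff δ f R w = ((δ (t + r) * f (coord r (shift t w)) : ℝ≥0) : ℝ≥0∞) ∧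
      hitPayoff δ f R (shift t w) = ((δ r * f (coord r (shift t w)) : ℝ≥0) : ℝ≥0∞) := by
  have h1 := rho_shift h
  rw [hr, ← ENNReal.coe_add] at h1
  refine ⟨?_, hitPayoff_of_eq h1, hitPayoff_of_eq hr⟩
  rw [h1, ENNReal.coe_lt_coe] at h
  exact pos_of_lt_add_right h

/-- This is `δ(t)δ(r) ≤ δ(t + r)`, with `r` the remaining time to `R`. -/
lemma mul_hitPayoff_shift_le (hδ0 : δ 0 = 1) (hδ : StrictImpatience δ)
    (h : (t : ℝ≥0∞) < rho coord R w) :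
    δ t * hitPayoff δ f R (shift t w) ≤ hitPayoff δ f R w := by
  rcases eq_or_ne (rho coord R (shift t w)) ∞ with hr | hr
  · simp [hitPayoff_of_top hr]
  lift rho coord R (shift t w) to ℝ≥0 using hr with r hr'
  obtain ⟨hr0, e1, e2⟩ := hitPayoff_of_lt_rho (δ := δ) (f := f) h hr'.symm
  rw [e1, e2, ← ENNReal.coe_mul, ENNReal.coe_le_coe, ← mul_assoc]
  gcongr
  rcases eq_or_ne t 0 with rfl | ht
  · simp [hδ0]
  · exact (hδ t r (pos_iff_ne_zero.2 ht) hr0).le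

lemma mul_hitPayoff_shift_lt (hδ : StrictImpatience δ) (ht : 0 < t)
    (h : (t : ℝ≥0∞) < rho coord R w) (h0 : hitPayoff δ f R (shift t w) ≠ 0) :
    δ t * hitPayoff δ f R (shift t w) < hitPayoff δ f R w := by
  rcases eq_or_ne (rho coord R (shift t w)) ∞ with hr | hr
  · exact absurd (hitPayoff_of_top hr) h0
  lift rho coord R (shift t w) to ℝ≥0 using hr with r hr'
  obtain ⟨hr0, e1, e2⟩ := hitPayoff_of_lt_rho (δ := δ) (f := f) h hr'.symm
  rw [e2, ENNReal.coe_ne_zero] at h0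
  rw [e1, e2, ← ENNReal.coe_mul, ENNReal.coe_lt_coe, ← mul_assoc]
  exact mul_lt_mul_of_pos_right (hδ t r ht hr0) (pos_iff_ne_zero.2 (right_ne_zero_of_mul h0))

/-- The payoff at the first time `t ≥ 0` at which the path is in `R`. -/
def entryPayoff (δ : ℝ≥0 → ℝ≥0) (f : S → ℝ≥0) (R : Set S) (w : ContPath S) : ℝ≥0∞ :=
  open Classical in if coord 0 w ∈ R then (f (coord 0 w) : ℝ≥0∞) else hitPayoff δ f R w

lemma measurable_entryPayoff (hδ : Measurable δ) (hf : Measurable f) (hR : IsClosed R) :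
    Measurable (entryPayoff δ f R) :=
  Measurable.ite (measurable_coord 0 hR.measurableSet)
    (hf.comp (measurable_coord 0)).coe_nnreal_ennreal (measurable_hitPayoff hδ hf hR)

/-- Allows `t = ρ(R)`: there the entry payoff is collected at once, whereas `hitPayoff` would wait
for a visit at a positive time. -/
lemma mul_entryPayoff_shift_le (hδ0 : δ 0 = 1) (hδ : StrictImpatience δ) (hR : IsClosed R)
    (ht : 0 < t) (h : (t : ℝ≥0∞) ≤ rho coord R w) :
    δ t * entryPayoff δ f R (shift t w) ≤ hitPayoff δ f R w := by
  by_cases hw : coord t w ∈ R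
  · have : rho coord R w = t := le_antisymm (rho_le ht hw) h
    rw [hitPayoff_of_eq this, entryPayoff, if_pos (by simpa using hw)]
    simp
  · rw [entryPayoff, if_neg (by simpa using hw)]
    refine mul_hitPayoff_shift_le hδ0 hδ (lt_of_le_of_ne h fun he => hw ?_)
    exact mem_of_rho_eq hR (continuous_coord w) he.symm

end Payoff

/-! ### Null events after a stopping time, and comparison of expected payoffs. -/

namespace IsContinuousStrongMarkov

variable {X : ℝ≥0 → Ω → S} {P : Kernel S Ω} (hX : IsContinuousStrongMarkov X P)
include hX

lemma ae_shift_iff {τ : Ω → WithTop ℝ≥0}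
    (hτ : IsStoppingTime (Filtration.natural X hX.stronglyMeasurable).rightCont τ)
    {N : Set (ContPath S)} (hN : MeasurableSet N) (x : S) :
    (∀ᵐ ω ∂(P x), τ ω ≠ ⊤ → shift ((τ ω).untopD 0) (hX.path ω) ∉ N) ↔
      ∀ᵐ ω ∂(P x), τ ω ≠ ⊤ → ∀ᵐ ω' ∂(P (X ((τ ω).untopD 0) ω)), hX.path ω' ∉ N := by
  have hτm : Measurable fun ω => (τ ω).untopD 0 :=
    ((WithTop.measurable_untopD 0).comp hτ.measurable).mono hτ.measurableSpace_le le_rfl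
  have hG : Measurable (N.indicator (1 : ContPath S → ℝ≥0∞)) := measurable_one.indicator hN
  have htop : MeasurableSet {ω | τ ω ≠ ⊤} := hτ.measurableSet_eq_top.compl
  have h := hX.setLIntegral_shift hτ MeasurableSet.univ hG x
  rw [univ_inter] at h
  have h1 : (∀ᵐ ω ∂(P x), τ ω ≠ ⊤ → shift ((τ ω).untopD 0) (hX.path ω) ∉ N) ↔
      ∫⁻ ω in {ω | τ ω ≠ ⊤},
        N.indicator (1 : ContPath S → ℝ≥0∞) (shift ((τ ω).untopD 0) (hX.path ω)) ∂(P x) = 0 := by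
    have hm : Measurable fun ω =>
        N.indicator (1 : ContPath S → ℝ≥0∞) (shift ((τ ω).untopD 0) (hX.path ω)) :=
      hG.comp (measurable_shift_comp hτm hX.measurable_path)
    rw [lintegral_eq_zero_iff hm, EventuallyEq, ae_restrict_iff' htop]
    simp
  have hm : Measurable fun ω => ∫⁻ ω', N.indicator (1 : ContPath S → ℝ≥0∞) (hX.path ω')
      ∂(P (X ((τ ω).untopD 0) ω)) :=
    (hX.measurable_lintegral_path hG).comp (measurable_coord_comp hτm hX.measurable_path)
  have hm' : Measurable fun ω => N.indicator (1 : ContPath S → ℝ≥0∞) (hX.path ω) :=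
    hG.comp hX.measurable_path
  rw [h1, h, lintegral_eq_zero_iff hm, EventuallyEq, ae_restrict_iff' htop]
  refine eventually_congr (Eventually.of_forall fun ω => ?_)
  simp only [mem_ofPred_eq, Pi.zero_apply]
  rw [lintegral_eq_zero_iff hm']
  simp [EventuallyEq]

lemma ae_shift_of_forall_ae {τ : Ω → WithTop ℝ≥0}
    (hτ : IsStoppingTime (Filtration.natural X hX.stronglyMeasurable).rightCont τ)
    {N : Set (ContPath S)} (hN : MeasurableSet N)
    (h : ∀ z, ∀ᵐ ω ∂(P z), hX.path ω ∉ N) (x : S) :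
    ∀ᵐ ω ∂(P x), τ ω ≠ ⊤ → shift ((τ ω).untopD 0) (hX.path ω) ∉ N :=
  (hX.ae_shift_iff hτ hN x).2 (Eventually.of_forall fun _ _ => h _)

lemma ae_shift_const_of_forall_ae {N : Set (ContPath S)} (hN : MeasurableSet N)
    (h : ∀ z, ∀ᵐ ω ∂(P z), hX.path ω ∉ N) (t : ℝ≥0) (x : S) :
    ∀ᵐ ω ∂(P x), shift t (hX.path ω) ∉ N := by
  filter_upwards [hX.ae_shift_of_forall_ae (isStoppingTime_const _ t) hN h x] with ω h
  exact h WithTop.coe_ne_top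

/-- Under regularity, a point of an open interval `G` reaches every other one without leaving `G`,
with positive probability. -/
lemma reachWithin_not_ae (hreg : IsRegular X P) {G : Set S} (hGo : IsOpen G)
    (hG : G.OrdConnected) {y z : S} (hy : y ∈ G) (hz : z ∈ G) (hyi : (y : ℝ) ∈ interior S) :
    ¬ ∀ᵐ ω ∂(P y), hX.path ω ∉ reachWithin G z := by
  intro hnull
  obtain ⟨D, hDc, hD⟩ := TopologicalSpace.exists_countable_dense ℝ≥0
  have hmeas := measurableSet_reachWithin hGo hz
  set N : Set (ContPath S) := {w | coord 0 w = y} ∩ reachWithin G z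
  have hN : MeasurableSet N := (measurable_coord 0 (measurableSet_singleton y)).inter hmeas
  have hN0 : ∀ a, ∀ᵐ ω ∂(P a), hX.path ω ∉ N := by
    intro a
    by_cases ha : a = y
    · subst ha
      filter_upwards [hnull] with ω h h' using h h'.2
    · filter_upwards [hX.initial a] with ω h h'
      exact ha (h.symm.trans h'.1)
  -- Paths that, restarted at their first positive-time visit to `y`, reach `z` within `G`; null
  -- from every starting point by the strong Markov property at that visit.
  set N' : Set (ContPath S) := {w | rho coord {y} w ≠ ∞} ∩
    {w | shift (rho coord {y} w).toNNReal w ∈ N}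
  have hρ : Measurable (rho (coord (S := S)) {y}) := measurable_rho_coord isClosed_singleton
  have hN' : MeasurableSet N' := (hρ (measurableSet_singleton _)).compl.inter
    (measurable_shift_comp hρ.ennreal_toNNReal measurable_id hN)
  have hN'0 : ∀ a, ∀ᵐ ω ∂(P a), hX.path ω ∉ N' := by
    intro a
    filter_upwards [hX.ae_shift_of_forall_ae (hX.isStoppingTime_rho isClosed_singleton) hN hN0 a]
      with ω h h'
    exact h h'.1 h'.2
  have hall : ∀ᵐ ω ∂(P y), ∀ q ∈ D, shift q (hX.path ω) ∉ N' :=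
    (ae_ball_iff hDc).2 fun q _ => hX.ae_shift_const_of_forall_ae hN' hN'0 q y
  refine (hreg y hyi z).ne' ?_
  rw [measure_eq_zero_iff_ae_notMem]
  filter_upwards [hall, hnull, hX.initial y] with ω h1 h2 h3 h4
  simp only [hitTime, iInf_lt_iff] at h4
  obtain ⟨t, ht, -⟩ := h4
  rcases reachWithin_of_hit hGo hG hD hy hz (w := hX.path ω) h3 ht with h | ⟨q, hq, r, hr, h⟩
  · exact h2 h
  · have hr' : (rho coord {y} (shift q (hX.path ω))).toNNReal = r := by simp [hr]
    refine h1 q hq ⟨by simp [hr], ?_⟩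
    simp only [mem_ofPred_eq, hr']
    exact ⟨by simpa using mem_of_rho_eq isClosed_singleton (continuous_coord _) hr, h⟩

variable {δ : ℝ≥0 → ℝ≥0} {f : S → ℝ≥0}

/-- The decay assumption turns the limsup convention on `ρ(R) = ∞` into payoff `0`. -/
lemma discountedPayoff_ae_eq (hdecay : DiscountedPayoffVanishes X P δ f) (x : S) :
    ∀ᵐ ω ∂(P x), ∀ R : Set S,
      discountedPayoff X δ f (rho X R ω) ω = hitPayoff δ f R (hX.path ω) := by
  filter_upwards [hdecay x] with ω h R
  rw [discountedPayoff, hitPayoff, rho_path]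
  split_ifs with hr
  · have : Tendsto (fun t => ((δ t * f (X t ω) : ℝ≥0) : ℝ≥0∞)) atTop (𝓝 ((0 : ℝ≥0) : ℝ≥0∞)) :=
      ENNReal.tendsto_coe.2 h
    simpa using this.limsup_eq
  · rfl

lemma J_eq_lintegral_hitPayoff (hdecay : DiscountedPayoffVanishes X P δ f) (x : S) (R : Set S) :
    J X P δ f x R = ∫⁻ ω, hitPayoff δ f R (hX.path ω) ∂(P x) := by
  refine lintegral_congr_ae ?_
  filter_upwards [hX.discountedPayoff_ae_eq hdecay x] with ω h using h R

variable (hδ : IsDiscount δ) (hδ' : StrictImpatience δ) (hf : Continuous f)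
  (hdecay : DiscountedPayoffVanishes X P δ f)
include hδ hf hdecay

lemma ae_hitPayoff_eq_zero_iff {R : Set S} (hR : IsClosed R) (x : S) :
    (∀ᵐ ω ∂(P x), hitPayoff δ f R (hX.path ω) = 0) ↔ J X P δ f x R = 0 := by
  have hm : Measurable fun ω => hitPayoff δ f R (hX.path ω) :=
    (measurable_hitPayoff hδ.continuous.measurable hf.measurable hR).comp hX.measurable_path
  rw [hX.J_eq_lintegral_hitPayoff hdecay, lintegral_eq_zero_iff hm]
  rfl

/-- If `J(·, R)` vanishes on an open set `G` disjoint from `R`, and so does `f`, then adding a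
part of `G` to `R` does not change `J`. -/
lemma J_union_eq {R G A : Set S} (hR : IsClosed R) (hG : IsOpen G)
    (hJ : ∀ y ∈ G, J X P δ f y R = 0) (hfG : ∀ y ∈ G, f y = 0) (hA : A ⊆ G) (x : S) :
    J X P δ f x (R ∪ A) = J X P δ f x R := by
  rw [hX.J_eq_lintegral_hitPayoff hdecay, hX.J_eq_lintegral_hitPayoff hdecay]
  obtain ⟨D, hDc, hD⟩ := TopologicalSpace.exists_countable_dense ℝ≥0
  set N : Set (ContPath S) := {w | coord 0 w ∈ G} ∩ {w | hitPayoff δ f R w ≠ 0}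
  have hN : MeasurableSet N := (measurable_coord 0 hG.measurableSet).inter
    ((measurable_hitPayoff hδ.continuous.measurable hf.measurable hR)
      (measurableSet_singleton 0)).compl
  have hN0 : ∀ a, ∀ᵐ ω ∂(P a), hX.path ω ∉ N := by
    intro a
    by_cases ha : a ∈ G
    · filter_upwards [(hX.ae_hitPayoff_eq_zero_iff hδ hf hdecay hR a).2 (hJ a ha)] with ω h h'
      exact h'.2 h
    · filter_upwards [hX.initial a] with ω h h'
      exact ha (h ▸ h'.1)
  have hall : ∀ᵐ ω ∂(P x), ∀ q ∈ D, shift q (hX.path ω) ∉ N :=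
    (ae_ball_iff hDc).2 fun q _ => hX.ae_shift_const_of_forall_ae hN hN0 q x
  refine lintegral_congr_ae ?_
  filter_upwards [hall] with ω h
  set w := hX.path ω
  have hc := continuous_coord w
  have hle : rho coord (R ∪ A) w ≤ rho coord R w := rho_anti subset_union_left
  rcases hle.eq_or_lt with he | hlt
  · rw [hitPayoff, hitPayoff, he]
  · obtain ⟨t, ht, htm, htR⟩ := rho_lt_iff.1 hlt
    have htA : coord t w ∈ G := by
      rcases htm with h1 | h1
      · exact absurd (rho_le ht h1) htR.not_ge
      · exact hA h1
    -- By openness of `G` the path is in `G` at some `q ∈ D` before hitting `R`, and from there the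
    -- payoff at `R` is almost surely zero.
    have hRz : hitPayoff δ f R w = 0 := by
      have h1 : {s | coord s w ∈ G} ∈ 𝓝 t := (hG.preimage hc).mem_nhds htA
      obtain ⟨l, hl, hsub⟩ := exists_Ioc_subset_of_mem_nhds h1 ⟨0, ht⟩
      obtain ⟨q, hqD, hq⟩ := hD.exists_between hl
      have hqR : (q : ℝ≥0∞) < rho coord R w := lt_trans (by exact_mod_cast hq.2) htR
      have h2 : hitPayoff δ f R (shift q w) = 0 := by
        by_contra hne
        exact h q hqD ⟨by simpa using hsub ⟨hq.1, hq.2.le⟩, hne⟩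
      rcases eq_or_ne (rho coord R (shift q w)) ∞ with hr | hr
      · exact hitPayoff_of_top (by rw [rho_shift hqR, hr]; simp)
      lift rho coord R (shift q w) to ℝ≥0 using hr with r hr'
      obtain ⟨-, e1, e2⟩ := hitPayoff_of_lt_rho (δ := δ) (f := f) hqR hr'.symm
      rw [e2, ENNReal.coe_eq_zero] at h2
      rw [e1, (mul_eq_zero.1 h2).resolve_left (hδ.pos r).ne']
      simp
    rw [hRz]
    lift rho coord (R ∪ A) w to ℝ≥0 using hlt.ne_top with r hr
    rw [hitPayoff_of_eq hr.symm]
    -- `A` is only Borel, so the infimum may be attained only in its closure, where `f` still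
    -- vanishes by continuity.
    have hcl : coord r w ∈ closure A := by
      by_contra hn
      have hmem : r ∈ {s | coord s w ∈ (closure A)ᶜ} := hn
      obtain ⟨u, hu, hsub⟩ := exists_Ico_subset_of_mem_nhds
        ((isClosed_closure.isOpen_compl.preimage hc).mem_nhds hmem) (exists_gt r)
      have hlt' : rho coord (R ∪ A) w < min (u : ℝ≥0∞) (rho coord R w) := by
        rw [← hr]
        exact lt_min (by exact_mod_cast hu) hlt
      obtain ⟨s, hs, hsm, hsu⟩ := rho_lt_iff.1 hlt'
      have hrs : r ≤ s := by
        have := rho_le hs hsm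
        rw [← hr] at this
        exact_mod_cast this
      refine hsub ⟨hrs, by exact_mod_cast hsu.trans_le (min_le_left _ _)⟩ ?_
      refine subset_closure (hsm.resolve_left fun h1 => ?_)
      exact (hsu.trans_le (min_le_right _ _)).not_ge (rho_le hs h1)
    have hf0 : f (coord r w) = 0 :=
      closure_minimal (fun a ha => hfG a (hA ha)) (isClosed_singleton.preimage hf) hcl
    simp [hf0]

include hδ'

/-- Values `J(·, R)` at two points of an open interval disjoint from `R` are comparable. -/
lemma exists_mul_J_le (hreg : IsRegular X P) {R G : Set S} (hR : IsClosed R) (hGo : IsOpen G)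
    (hG : G.OrdConnected) (hGR : Disjoint G R) {y z : S} (hy : y ∈ G) (hz : z ∈ G)
    (hyi : (y : ℝ) ∈ interior S) :
    ∃ c : ℝ≥0∞, c ≠ 0 ∧ c * J X P δ f z R ≤ J X P δ f y R := by
  rcases eq_or_ne y z with rfl | hyz
  · exact ⟨1, one_ne_zero, by simp⟩
  have hτ := hX.isStoppingTime_rho (isClosed_singleton (x := z))
  have hτR := hX.isStoppingTime_rho hR
  set E : Set Ω := {ω | (rho X {z} ω : WithTop ℝ≥0) ≤ rho X R ω} with hEdef
  have hE : MeasurableSet[hτ.measurableSpace] E := hτ.measurableSet_le_stopping_time hτR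
  set c : Ω → ℝ≥0∞ := E.indicator fun ω => (δ (rho X {z} ω).toNNReal : ℝ≥0∞)
  have hc : Measurable[hτ.measurableSpace] c := by
    refine Measurable.indicator ?_ hE
    exact (hδ.continuous.measurable.comp
      ((WithTop.measurable_untopD 0).comp hτ.measurable)).coe_nnreal_ennreal
  have hphi := measurable_hitPayoff hδ.continuous.measurable hf.measurable hR
  have htop : MeasurableSet {ω | rho X {z} ω ≠ ∞} := hτ.measurableSet_eq_top.compl
  have hmem : ∀ ω, rho X {z} ω ≠ ∞ → X (rho X {z} ω).toNNReal ω = z := fun ω h =>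
    mem_of_rho_eq isClosed_singleton (hX.continuous_paths ω) (ENNReal.coe_toNNReal h).symm
  have hcm : Measurable c := hc.mono hτ.measurableSpace_le le_rfl
  -- The constant is the expected discount factor on reaching `z` no later than `R`. Ties at a
  -- finite time cannot occur, since `z ∉ R`.
  refine ⟨∫⁻ ω in {ω | rho X {z} ω ≠ ∞}, c ω ∂(P y), ?_, ?_⟩
  · rw [Ne, lintegral_eq_zero_iff hcm, EventuallyEq, ae_restrict_iff' htop]
    intro h0
    refine hX.reachWithin_not_ae hreg hGo hG hy hz hyi ?_
    filter_upwards [h0, hX.initial y] with ω h1 h2 h3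
    rcases (mem_reachWithin_iff hGo hz).1 h3 with h4 | ⟨-, h4⟩
    · exact hyz (h2.symm.trans h4)
    · have hlt : rho X {z} ω < rho X R ω :=
        h4.trans_le (rho_anti fun a ha haG => hGR.ne_of_mem haG ha rfl)
      have h5 := h1 hlt.ne_top
      have hωE : ω ∈ E := hlt.le
      simp only [c, indicator_of_mem hωE, Pi.zero_apply, ENNReal.coe_eq_zero] at h5
      exact (hδ.pos _).ne' h5
  · calc (∫⁻ ω in {ω | rho X {z} ω ≠ ∞}, c ω ∂(P y)) * J X P δ f z R
        = ∫⁻ ω in {ω | rho X {z} ω ≠ ∞}, c ω * J X P δ f z R ∂(P y) :=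
          (lintegral_mul_const _ hcm).symm
      _ = ∫⁻ ω in {ω | rho X {z} ω ≠ ∞}, c ω * ∫⁻ ω', hitPayoff δ f R (hX.path ω')
            ∂(P (X (rho X {z} ω).toNNReal ω)) ∂(P y) := by
          refine setLIntegral_congr_fun htop fun ω hω => ?_
          rw [hmem ω hω, hX.J_eq_lintegral_hitPayoff hdecay]
      _ = ∫⁻ ω in {ω | rho X {z} ω ≠ ∞},
            c ω * hitPayoff δ f R (shift (rho X {z} ω).toNNReal (hX.path ω)) ∂(P y) :=
          (hX.setLIntegral_mul_shift hτ hc hphi y).symm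
      _ ≤ ∫⁻ ω in {ω | rho X {z} ω ≠ ∞}, hitPayoff δ f R (hX.path ω) ∂(P y) := by
          refine setLIntegral_mono' htop fun ω hω => ?_
          by_cases hωE : ω ∈ E
          · simp only [c, indicator_of_mem hωE]
            refine mul_hitPayoff_shift_le hδ.zero hδ' ?_
            rw [ENNReal.coe_toNNReal hω]
            refine lt_of_le_of_ne hωE fun he => ?_
            have h1 : X (rho X {z} ω).toNNReal ω ∈ R :=
              mem_of_rho_eq hR (hX.continuous_paths ω)
                (by rw [ENNReal.coe_toNNReal hω]; exact he.symm)
            rw [hmem ω hω] at h1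
            exact hGR.ne_of_mem hz h1 rfl
          · simp [c, indicator_of_notMem hωE]
      _ ≤ ∫⁻ ω, hitPayoff δ f R (hX.path ω) ∂(P y) := setLIntegral_le_lintegral _ _
      _ = _ := (hX.J_eq_lintegral_hitPayoff hdecay y R).symm

/-- Stopping already in a larger set `T`, on which `R` is indifferent, is strictly worse from
points of an open interval in which `T` has a point but `R` has none. -/
lemma J_lt_J (hreg : IsRegular X P) {R T G : Set S} (hR : IsClosed R) (hT : IsClosed T)
    (hRT : R ⊆ T) (hGo : IsOpen G) (hG : G.OrdConnected) (hGR : Disjoint G R)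
    (hGi : ∀ a ∈ G, (a : ℝ) ∈ interior S) (hTR : ∀ a ∈ T, a ∉ R → J X P δ f a R = f a)
    {x y z : S} (hx : x ∈ G) (hxT : x ∉ T) (hy : y ∈ G) (hyT : y ∈ T) (hz : z ∈ G)
    (hJz : J X P δ f z R ≠ 0) : J X P δ f x T < J X P δ f x R := by
  have hpos : ∀ a ∈ G, J X P δ f a R ≠ 0 := by
    intro a ha h0
    obtain ⟨c, hc0, hc⟩ := hX.exists_mul_J_le hδ hδ' hf hdecay hreg hR hGo hG hGR ha hz (hGi a ha)
    rw [h0, nonpos_iff_eq_zero] at hc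
    exact (mul_ne_zero hc0 hJz) hc
  -- An infinite value at `x` would spread to `y`, where `J(y, R) = f(y)` is finite.
  have hfin : J X P δ f x R ≠ ∞ := by
    intro htop
    obtain ⟨c, hc0, hc⟩ := hX.exists_mul_J_le hδ hδ' hf hdecay hreg hR hGo hG hGR hy hx (hGi y hy)
    rw [htop, ENNReal.mul_top hc0, hTR y hyT fun h => hGR.ne_of_mem hy h rfl] at hc
    exact ENNReal.coe_ne_top (top_le_iff.1 hc)
  have hτ := hX.isStoppingTime_rho hT
  have hδm := hδ.continuous.measurable
  have htop : MeasurableSet {ω | rho X T ω ≠ ∞} := hτ.measurableSet_eq_top.compl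
  have hc : Measurable[hτ.measurableSpace] fun ω => (δ (rho X T ω).toNNReal : ℝ≥0∞) :=
    (hδm.comp ((WithTop.measurable_untopD 0).comp hτ.measurable)).coe_nnreal_ennreal
  have hmem : ∀ ω, rho X T ω ≠ ∞ → X (rho X T ω).toNNReal ω ∈ T := fun ω h =>
    mem_of_rho_eq hT (hX.continuous_paths ω) (ENNReal.coe_toNNReal h).symm
  -- On `T`, the number `f(a)` is the expected entry payoff into `R`: immediate on `R`, by
  -- indifference off `R`. So the reward at `ρ(T)` can be replaced by a continuation to `R`.
  have hentry : ∀ a ∈ T, ∫⁻ ω, entryPayoff δ f R (hX.path ω) ∂(P a) = f a := by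
    intro a ha
    have := hX.isMarkovKernel
    by_cases haR : a ∈ R
    · calc _ = ∫⁻ _, (f a : ℝ≥0∞) ∂(P a) := by
            refine lintegral_congr_ae ?_
            filter_upwards [hX.initial a] with ω h
            rw [entryPayoff, coord_path, h, if_pos haR]
        _ = f a := by simp
    · rw [← hTR a ha haR, hX.J_eq_lintegral_hitPayoff hdecay]
      refine lintegral_congr_ae ?_
      filter_upwards [hX.initial a] with ω h
      rw [entryPayoff, coord_path, h, if_neg haR]
  set g : Ω → ℝ≥0∞ := {ω | rho X T ω ≠ ∞}.indicator fun ω =>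
    (δ (rho X T ω).toNNReal : ℝ≥0∞) *
      entryPayoff δ f R (shift (rho X T ω).toNNReal (hX.path ω)) with hg
  have hJT : J X P δ f x T = ∫⁻ ω, g ω ∂(P x) := by
    have h : ∫⁻ ω, g ω ∂(P x) = ∫⁻ ω in {ω | rho X T ω ≠ ∞}, (δ (rho X T ω).toNNReal : ℝ≥0∞) *
        ∫⁻ ω', entryPayoff δ f R (hX.path ω') ∂(P (X (rho X T ω).toNNReal ω)) ∂(P x) := by
      rw [hg, lintegral_indicator htop]
      exact hX.setLIntegral_mul_shift hτ hc (measurable_entryPayoff hδm hf.measurable hR) x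
    rw [h, hX.J_eq_lintegral_hitPayoff hdecay, ← lintegral_indicator htop]
    refine lintegral_congr fun ω => ?_
    by_cases hω : rho X T ω = ∞
    · rw [indicator_of_notMem (by simpa using hω)]
      exact hitPayoff_of_top hω
    · rw [indicator_of_mem (by simpa using hω)]
      rw [hentry _ (hmem ω hω), ← ENNReal.coe_mul]
      exact hitPayoff_of_eq (ENNReal.coe_toNNReal hω).symm
  have hτpos : ∀ᵐ ω ∂(P x), 0 < rho X T ω := by
    filter_upwards [hX.initial x] with ω h
    exact rho_pos hT (hX.continuous_paths ω) (h ▸ hxT)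
  have hle : g ≤ᵐ[P x] fun ω => hitPayoff δ f R (hX.path ω) := by
    filter_upwards [hτpos] with ω h0
    by_cases hω : rho X T ω = ∞
    · rw [hg, indicator_of_notMem (by simpa using hω)]
      exact zero_le
    · rw [hg, indicator_of_mem (by simpa using hω)]
      refine mul_entryPayoff_shift_le hδ.zero hδ' hR (ENNReal.toNNReal_pos h0.ne' hω) ?_
      rw [ENNReal.coe_toNNReal hω]
      exact rho_anti hRT
  have hphi := measurable_hitPayoff hδm hf.measurable hR
  rw [hJT, hX.J_eq_lintegral_hitPayoff hdecay x R]
  set N : Set (ContPath S) := {w | coord 0 w ∈ G} ∩ {w | hitPayoff δ f R w ≠ 0}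
  have hN : MeasurableSet N := (measurable_coord 0 hGo.measurableSet).inter
    (hphi (measurableSet_singleton 0)).compl
  -- Strictness is obtained on the event that `T` is first met inside `G` and the continuation from
  -- there pays something.
  refine lintegral_strict_mono_of_ae_le_of_ae_lt_on (hphi.comp hX.measurable_path).aemeasurable
    ?_ hle (s := {ω | rho X T ω ≠ ∞ ∧ shift (rho X T ω).toNNReal (hX.path ω) ∈ N}) ?_ ?_
  · refine ne_top_of_le_ne_top hfin ?_
    rw [hX.J_eq_lintegral_hitPayoff hdecay]
    exact lintegral_mono_ae hle
  · rw [Ne, measure_eq_zero_iff_ae_notMem]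
    intro h0
    have h1 : ∀ᵐ ω ∂(P x), rho X T ω ≠ ∞ →
        ∀ᵐ ω' ∂(P (X (rho X T ω).toNNReal ω)), hX.path ω' ∉ N := by
      refine (hX.ae_shift_iff hτ hN x).1 ?_
      filter_upwards [h0] with ω h h2 h3 using h ⟨h2, h3⟩
    -- If that event were null, a path reaching `y` within `G` would meet `T` at a point of `G` with
    -- `J(·, R) = 0`, which `hpos` forbids.
    refine hX.reachWithin_not_ae hreg hGo hG hx hy (hGi x hx) ?_
    filter_upwards [h1, hX.initial x] with ω h2 h3 h4
    obtain ⟨t, hty, htG⟩ := h4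
    have htT : X t ω ∈ T := (show X t ω = y from hty) ▸ hyT
    have ht0 : t ≠ 0 := by
      rintro rfl
      exact hxT (h3 ▸ htT)
    have hρt : rho X T ω ≤ t := rho_le (pos_iff_ne_zero.2 ht0) htT
    have hρ : rho X T ω ≠ ∞ := ne_top_of_le_ne_top ENNReal.coe_ne_top hρt
    have haG : X (rho X T ω).toNNReal ω ∈ G :=
      htG _ (by rw [← ENNReal.coe_le_coe, ENNReal.coe_toNNReal hρ]; exact hρt)
    refine hpos _ haG ((hX.ae_hitPayoff_eq_zero_iff hδ hf hdecay hR _).1 ?_)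
    filter_upwards [h2 hρ, hX.initial (X (rho X T ω).toNNReal ω)] with ω' h5 h6
    by_contra hne
    exact h5 ⟨by simpa [h6] using haG, hne⟩
  · filter_upwards [hτpos] with ω h0 hω
    have hne : coord (rho X T ω).toNNReal (hX.path ω) ∉ R := fun h =>
      hGR.ne_of_mem hω.2.1 h (by simp)
    rw [hg, indicator_of_mem (by simpa using hω.1), entryPayoff, if_neg (by simpa using hne)]
    refine mul_hitPayoff_shift_lt hδ' (ENNReal.toNNReal_pos h0.ne' hω.1) ?_ hω.2.2
    refine lt_of_le_of_ne ?_ fun he => hne ?_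
    · rw [ENNReal.coe_toNNReal hω.1]
      exact rho_anti hRT
    · exact mem_of_rho_eq hR (continuous_coord _) he.symm

end IsContinuousStrongMarkov

/-! ### Comparing two optimal equilibria. -/

section Equilibrium

variable {X : ℝ≥0 → Ω → S} {P : Kernel S Ω} {δ : ℝ≥0 → ℝ≥0} {f : S → ℝ≥0} {R T : Set S} {z : S}

lemma IsEquilibrium.J_le (h : IsEquilibrium X P δ f R) (hz : z ∈ R) : J X P δ f z R ≤ f z := by
  rw [← h.2] at hz
  rcases hz with hz | hz
  · exact le_of_lt hz
  · exact hz.1.ge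

lemma IsEquilibrium.le_J (h : IsEquilibrium X P δ f R) (hz : z ∉ R) : f z ≤ J X P δ f z R := by
  rw [← h.2] at hz
  exact not_lt.1 fun hlt => hz (Or.inl hlt)

lemma IsOptimalEquilibrium.V_eq (hR : IsOptimalEquilibrium X P δ f R)
    (hT : IsOptimalEquilibrium X P δ f T) (z : S) : V X P δ f z R = V X P δ f z T :=
  le_antisymm (hT.2 R hR.1 z) (hR.2 T hT.1 z)

/-- The common value equals `f` on `T`, where stopping is a best response, and `J(·, R)` off `R`. -/
lemma IsOptimalEquilibrium.J_eq_of_mem (hR : IsOptimalEquilibrium X P δ f R)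
    (hT : IsOptimalEquilibrium X P δ f T) (hz : z ∈ T) (hzR : z ∉ R) :
    J X P δ f z R = f z := by
  have h := hR.V_eq hT z
  rw [V, V, max_eq_right (hR.1.le_J hzR), max_eq_left (hT.1.J_le hz)] at h
  exact h

lemma IsOptimalEquilibrium.J_eq_of_notMem (hR : IsOptimalEquilibrium X P δ f R)
    (hT : IsOptimalEquilibrium X P δ f T) (hz : z ∉ T) (hzR : z ∉ R) :
    J X P δ f z R = J X P δ f z T := by
  have h := hR.V_eq hT z
  rwa [V, V, max_eq_right (hR.1.le_J hzR), max_eq_right (hT.1.le_J hz)] at h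

lemma isClosed_Rstar : IsClosed (Rstar X P δ f) := isClosed_sInter fun _ h => h.2

end Equilibrium

end NonExpStopping
end

/-! ### The trichotomy on a gap. -/

open NonExpStopping
theorem corollary5p1 {S : Set ℝ} (hS : S.OrdConnected)
    {Ω : Type*} [MeasurableSpace Ω] (X : ℝ≥0 → Ω → S) (P : Kernel S Ω)
    (hX : IsContinuousStrongMarkov X P) (hreg : IsRegular X P)
    (δ : ℝ≥0 → ℝ≥0) (hδ : IsDiscount δ) (hδ' : StrictImpatience δ)
    (f : S → ℝ≥0) (hf : Continuous f) (hdecay : DiscountedPayoffVanishes X P δ f)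
    (hopt : IsOptimalEquilibrium X P δ f (Rstar X P δ f))
    (T : Set S) (hT : IsClosed T) (hTopt : IsOptimalEquilibrium X P δ f T)
    (x : S) (hx : x ∉ Rstar X P δ f) :
    ((gap (Rstar X P δ f) x ∩ contRegion X P δ f (Rstar X P δ f)).Nonempty →
      T ∩ gap (Rstar X P δ f) x = ∅) ∧
    (gap (Rstar X P δ f) x ∩ contRegion X P δ f (Rstar X P δ f) = ∅ →
      (∃ y ∈ gap (Rstar X P δ f) x, f y ≠ 0) →
      T ∩ gap (Rstar X P δ f) x = ∅ ∨ gap (Rstar X P δ f) x ⊆ T) ∧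
    (gap (Rstar X P δ f) x ∩ contRegion X P δ f (Rstar X P δ f) = ∅ →
      (∀ y ∈ gap (Rstar X P δ f) x, f y = 0) →
      ∀ A ⊆ gap (Rstar X P δ f) x, MeasurableSet A →
        IsOptimalEquilibrium X P δ f (Rstar X P δ f ∪ A)) := by
  set R := Rstar X P δ f
  have hR : IsClosed R := isClosed_Rstar
  have hRT : R ⊆ T := sInter_subset_of_mem ⟨hTopt.1, hT⟩
  have hgapR : ∀ y ∈ gap R x, y ∉ R := fun y hy => notMem_of_mem_gap hx hy
  -- Core dichotomy: once `J(·, R)` is nonzero somewhere on the gap, `T` contains all of the gap or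
  -- none of it.
  have hnot : ∀ a ∈ gap R x, a ∉ T → ∀ y ∈ gap R x, y ∈ T → ∀ z ∈ gap R x,
      J X P δ f z R ≠ 0 → False := by
    intro a ha haT y hy hyT z hz hJz
    have h := hX.J_lt_J hδ hδ' hf hdecay hreg hR hT hRT isOpen_gap gap_ordConnected
      (disjoint_left.2 hgapR) (fun _ h => mem_interior_of_mem_gap hS h)
      (fun b hb hbR => hopt.J_eq_of_mem hTopt hb hbR) ha haT hy hyT hz hJz
    exact h.ne (hopt.J_eq_of_notMem hTopt haT (hgapR a ha)).symm
  refine ⟨?_, ?_, ?_⟩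
  · rintro ⟨a, ha, hlt⟩
    have haJ : (f a : ℝ≥0∞) < J X P δ f a R := hlt
    have haT : a ∉ T := fun h => haJ.ne' (hopt.J_eq_of_mem hTopt h (hgapR a ha))
    refine eq_empty_of_forall_notMem fun y hy => ?_
    exact hnot a ha haT y hy.2 hy.1 a ha (ne_bot_of_gt haJ)
  · rintro - ⟨z, hz, hfz⟩
    by_contra! hcon
    obtain ⟨⟨y, hy⟩, hsub⟩ := hcon
    obtain ⟨a, ha, haT⟩ := not_subset.1 hsub
    refine hnot a ha haT y hy.2 hy.1 z hz fun h0 => hfz ?_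
    have := hopt.1.le_J (hgapR z hz)
    rw [h0] at this
    simpa using this
  · intro hC hf0 A hA hAm
    have hJ0 : ∀ y ∈ gap R x, J X P δ f y R = 0 := by
      intro y hy
      by_contra hne
      refine (eq_empty_iff_forall_notMem.1 hC) y ⟨hy, ?_⟩
      change (f y : ℝ≥0∞) < _
      rw [hf0 y hy]
      exact pos_iff_ne_zero.2 hne
    have hJ : ∀ z, J X P δ f z (R ∪ A) = J X P δ f z R :=
      hX.J_union_eq hδ hf hdecay hR isOpen_gap hJ0 hf0 hA
    refine ⟨⟨hopt.1.1.union hAm, ?_⟩, fun T' hT' z => ?_⟩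
    -- With `J` unchanged, the best response to `R ∪ A` is that to `R` together with the indifferent
    -- points of `A`, which are all of `A`.
    · have hAI : A ⊆ indiffRegion X P δ f R := fun a ha => by
        change (f a : ℝ≥0∞) = _
        rw [hJ0 a (hA ha), hf0 a (hA ha)]
        rfl
      have h := hopt.1.2
      simp only [Theta, stopRegion, indiffRegion, hJ] at h hAI ⊢
      rw [inter_union_distrib_left, ← union_assoc, h, inter_eq_right.2 hAI]
    · simpa only [V, hJ] using hopt.2 T' hT' z
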